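/- Let $u\in C^3(\mathbb R^2)$ be real-valued with $\inf_{\mathbb R^2}|\nabla u|>0$. Then there exists $\Phi\in C^1(\mathbb R^2;\mathbb R^2)$ whose Jacobian matrix $\nabla\Phi(x)=(\partial\Phi_i/\partial x_j(x))_{i,j}$ is invertible at every $x\in\mathbb R^2$ and such that $$\nabla\Phi\,\nabla u=e_1=\begin{pmatrix}1\\0\end{pmatrix}\quad\text{in }\mathbb R^2 .$$ Consequently $\nabla u$ is globally rectified: for every solution $X$ of $X'=\nabla u(X)$, the curve $Y=\Phi(X)$ solves $Y'=e_1$. Moreover $\Phi$ can be taken of the form $\Phi=(-\tau,v)$, where, denoting by $X(\cdot,x)$ the maximal solution of $\partial_tX(t,x)=\nabla u(X(t,x))$, $X(0,x)=x$: - $\tau\in C^1(\mathbb R^2)$, and for each $x\in\mathbb R^2$, $\tau(x)$ is the unique time $t$ (of either sign) in the interval of existence of $X(\cdot,x)$ for which $u(X(t,x))=0$; - the function $\sigma(x)=\exp\Big(\int_0^{\tau(x)}\Delta u(X(s,x))\,ds\Big)>0$ belongs to $C^1(\mathbb R^2)$ and satisfies $\mathrm{div}(\sigma\nabla u)=0$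 in $\mathbb R^2$; - $v\in C^1(\mathbb R^2)$ is a stream function of $\sigma\nabla u$, that is $\sigma\nabla u=\nabla^\perp v:=(-\partial_{x_2}v,\partial_{x_1}v)$ in $\mathbb R^2$. -/

import Mathlib

/-- The Euclidean plane. -/
abbrev Plane : Type := EuclideanSpace ℝ (Fin 2)

namespace Plane

/-- The standard basis vector `e i`; thus `e 0` is the vector with coordinates `(1, 0)`. -/
noncomputable def e (i : Fin 2) : Plane := EuclideanSpace.single i (1 : ℝ)

/-- The Jacobian matrix of `Φ` at `x`: entry `(i, j)` is `∂Φᵢ/∂xⱼ (x)`. -/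
noncomputable def jacobian (Φ : Plane → Plane) (x : Plane) : Matrix (Fin 2) (Fin 2) ℝ :=
  Matrix.of fun i j => fderiv ℝ Φ x (e j) i

/-- The divergence `∂F₁/∂x₁ + ∂F₂/∂x₂` of a planar vector field. -/
noncomputable def divergence (F : Plane → Plane) (x : Plane) : ℝ :=
  ∑ i, fderiv ℝ (fun y => F y i) x (e i)

/-- The rotated gradient `(-∂v/∂x₂, ∂v/∂x₁)`. -/
noncomputable def perpGradient (v : Plane → ℝ) (x : Plane) : Plane :=
  !₂[-(fderiv ℝ v x (e 1)), fderiv ℝ v x (e 0)]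

/-- `γ` solves `γ' = ∇u(γ)` on the compact time interval between `0` and `T` (of either sign),
with `γ 0 = x`. -/
def IsGradientTrajectory (u : Plane → ℝ) (x : Plane) (T : ℝ) (γ : ℝ → Plane) : Prop :=
  γ 0 = x ∧ IsIntegralCurveOn γ (fun _ y => gradient u y) (Set.uIcc 0 T)

/-- The gradient trajectory issued from `x` exists between the times `0` and `T`
and is on the equipotential `{u = 0}` at time `T`. -/
def ReachesZeroLevelAt (u : Plane → ℝ) (x : Plane) (T : ℝ) : Prop :=
  ∃ γ : ℝ → Plane, IsGradientTrajectory u x T γ ∧ u (γ T) = 0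

end Plane

/-!
Dividing `∇u` by `|∇u|²` only changes the time along its trajectories. The new field is bounded,
because `inf |∇u| > 0`, hence complete, and `u` grows at unit speed along it, so every trajectory
crosses `{u = 0}` exactly once: the orbit of `x` does so at time `-u x`. The integral `A` of a `C¹`
function `g` along the trajectory of `∇u` from `x` to `{u = 0}` therefore exists for all `x`, is
`C¹` in `x`, and solves the transport equation `∇A · ∇u = -g`. Taking `g = 1` gives `τ`; taking
`g = Δu` gives `log σ`, and the transport equation then says `div (σ∇u) = σ (∇log σ · ∇u + Δu) = 0`,
so that `σ∇u` has a stream function `v`. For `Φ = (-τ, v)` this yields `∇Φ ∇u = (1, 0)`, and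
`det ∇Φ = ∇τ · ∇⊥v = σ ∇τ · ∇u = -σ` does not vanish.

The `C¹` dependence of orbits on their initial point and duration comes from the implicit function
theorem for the Picard operator on `C([0, 1], E)`: its linearisation is `1 - V` with `V` a Volterra
operator, which is invertible because some power of `V` is a contraction.
-/

section Nemytskii

variable {K E F : Type*} [TopologicalSpace K] [CompactSpace K]
  [NormedAddCommGroup E] [NormedSpace ℝ E] [NormedAddCommGroup F] [NormedSpace ℝ F]

/-- Pointwise application `(A, h) ↦ (t ↦ A t (h t))` of a continuous family of operators to a
continuous function, as a bounded bilinear map. -/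
noncomputable def pointwiseApplyL : C(K, E →L[ℝ] F) →L[ℝ] C(K, E) →L[ℝ] C(K, F) :=
  LinearMap.mkContinuous₂
    (LinearMap.mk₂ ℝ (fun (A : C(K, E →L[ℝ] F)) (h : C(K, E)) =>
        (⟨fun t => A t (h t), A.continuous.clm_apply h.continuous⟩ : C(K, F)))
      (fun _ _ _ => by ext; simp) (fun _ _ _ => by ext; simp)
      (fun _ _ _ => by ext; simp) (fun _ _ _ => by ext; simp)) 1
    (fun A h => by
      rw [one_mul]
      refine (ContinuousMap.norm_le _ (by positivity)).2 fun t => ?_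
      exact (A t).le_of_opNorm_le_of_le (A.norm_coe_le_norm t) (h.norm_coe_le_norm t))

@[simp]
theorem pointwiseApplyL_apply (A : C(K, E →L[ℝ] F)) (h : C(K, E)) (t : K) :
    pointwiseApplyL A h t = A t (h t) :=
  rfl

theorem hasFDerivAt_continuousMap_comp {G : C(E, F)} {G' : C(E, E →L[ℝ] F)}
    (hG : ∀ y, HasFDerivAt G (G' y) y) (γ : C(K, E)) :
    HasFDerivAt (fun γ : C(K, E) => G.comp γ) (pointwiseApplyL (G'.comp γ)) γ := by
  rw [hasFDerivAt_iff_isLittleO, Asymptotics.isLittleO_iff]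
  intro ε hε
  obtain ⟨δ, hδ, hball⟩ :=
    (Metric.continuousAt_iff (α := C(K, E)) (β := C(K, E →L[ℝ] F))).1
      G'.continuous_postcomp.continuousAt ε hε
  filter_upwards [Metric.ball_mem_nhds γ hδ] with γ' hγ'
  refine (ContinuousMap.norm_le _ (by positivity)).2 fun t => ?_
  -- a point of the segment from `γ t` to `γ' t` is the value at `t` of a convex combination
  -- of `γ` and `γ'`, hence of a function in the ball
  have hG'_segment : ∀ z ∈ segment ℝ (γ t) (γ' t), ‖G' z - G' (γ t)‖ ≤ ε := by
    rintro z ⟨a, b, ha, hb, hab, rfl⟩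
    have hmem : a • γ + b • γ' ∈ Metric.ball γ δ :=
      convex_ball γ δ (Metric.mem_ball_self hδ) hγ' ha hb hab
    simpa [dist_eq_norm] using (ContinuousMap.dist_apply_le_dist t).trans (hball hmem).le
  have hmean : ‖G (γ' t) - G (γ t) - G' (γ t) (γ' t - γ t)‖ ≤ ε * ‖γ' t - γ t‖ :=
    (convex_segment (γ t) (γ' t)).norm_image_sub_le_of_norm_hasFDerivWithin_le'
      (fun z _ => (hG z).hasFDerivWithinAt) hG'_segment
      (left_mem_segment ..) (right_mem_segment ..)
  refine hmean.trans ?_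
  gcongr
  exact (γ' - γ).norm_coe_le_norm t

theorem contDiff_continuousMap_comp {G : C(E, F)} (hG : ContDiff ℝ 1 G) :
    ContDiff ℝ 1 fun γ : C(K, E) => G.comp γ := by
  let G' : C(E, E →L[ℝ] F) := ⟨fderiv ℝ G, hG.continuous_fderiv one_ne_zero⟩
  refine contDiff_one_iff_hasFDerivAt.2 ⟨fun γ => pointwiseApplyL (G'.comp γ),
    pointwiseApplyL.continuous.comp G'.continuous_postcomp,
    hasFDerivAt_continuousMap_comp fun y => ?_⟩
  exact (hG.differentiable one_ne_zero y).hasFDerivAt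

end Nemytskii

section Volterra

open Set unitInterval

variable {E : Type*} [NormedAddCommGroup E] [NormedSpace ℝ E]

/-- The operator taking a continuous function on the unit interval to its primitive vanishing
at `0`. -/
noncomputable def primitiveL : C(I, E) →L[ℝ] C(I, E) :=
  LinearMap.mkContinuous
    { toFun := fun h => ⟨fun t => ∫ s in (0 : ℝ)..t, IccExtend zero_le_one h s,
        (intervalIntegral.continuous_primitive
          (fun _ _ => (h.continuous.Icc_extend' (h := zero_le_one)).intervalIntegrable _ _) 0).comp
          continuous_subtype_val⟩
      map_add' := fun h k => by
        ext t
        exact intervalIntegral.integral_add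
          ((h.continuous.Icc_extend' (h := zero_le_one)).intervalIntegrable _ _)
          ((k.continuous.Icc_extend' (h := zero_le_one)).intervalIntegrable _ _)
      map_smul' := fun c h => by
        ext t
        exact intervalIntegral.integral_smul c _ } 1
    (fun h => by
      rw [one_mul]
      refine (ContinuousMap.norm_le _ (by positivity)).2 fun t => ?_
      refine (intervalIntegral.norm_integral_le_of_norm_le_const (C := ‖h‖)
        fun s _ => h.norm_coe_le_norm _).trans ?_
      rw [sub_zero, abs_of_nonneg t.2.1]
      exact mul_le_of_le_one_right (norm_nonneg _) t.2.2)

theorem primitiveL_apply_of_forall_eq {h : C(I, E)} {f : ℝ → E} (hf : ∀ s : I, h s = f s)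
    (t : I) : primitiveL h t = ∫ s in (0 : ℝ)..t, f s := by
  refine intervalIntegral.integral_congr fun s hs => ?_
  rw [uIcc_of_le t.2.1] at hs
  have hsI : s ∈ I := ⟨hs.1, hs.2.trans t.2.2⟩
  exact (IccExtend_of_mem _ _ hsI).trans (hf ⟨s, hsI⟩)

/-- The Volterra operator `h ↦ (t ↦ ∫ s in 0..t, A s (h s))`. -/
noncomputable def volterra (A : C(I, E →L[ℝ] E)) : C(I, E) →L[ℝ] C(I, E) :=
  primitiveL ∘L pointwiseApplyL A

theorem norm_volterra_pow_apply_le (A : C(I, E →L[ℝ] E)) (n : ℕ) (h : C(I, E)) (t : I) :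
    ‖(volterra A ^ n) h t‖ ≤ ‖A‖ ^ n * (t : ℝ) ^ n / n.factorial * ‖h‖ := by
  induction n generalizing t with
  | zero => simpa using h.norm_coe_le_norm t
  | succ n ih =>
    have hbound : ∀ s ∈ Ioc (0 : ℝ) t,
        ‖IccExtend zero_le_one (pointwiseApplyL A ((volterra A ^ n) h)) s‖ ≤
          ‖A‖ ^ (n + 1) / n.factorial * ‖h‖ * s ^ n := by
      intro s hs
      have hsI : s ∈ I := ⟨hs.1.le, hs.2.trans t.2.2⟩
      rw [IccExtend_of_mem _ _ hsI, pointwiseApplyL_apply]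
      calc ‖A ⟨s, hsI⟩ ((volterra A ^ n) h ⟨s, hsI⟩)‖
          ≤ ‖A‖ * (‖A‖ ^ n * s ^ n / n.factorial * ‖h‖) :=
            (A ⟨s, hsI⟩).le_of_opNorm_le_of_le (A.norm_coe_le_norm _) (ih ⟨s, hsI⟩)
        _ = ‖A‖ ^ (n + 1) / n.factorial * ‖h‖ * s ^ n := by ring
    calc ‖(volterra A ^ (n + 1)) h t‖
        = ‖∫ s in (0 : ℝ)..t,
            IccExtend zero_le_one (pointwiseApplyL A ((volterra A ^ n) h)) s‖ := by
          rw [pow_succ']; rfl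
      _ ≤ ∫ s in (0 : ℝ)..t, ‖A‖ ^ (n + 1) / n.factorial * ‖h‖ * s ^ n :=
          intervalIntegral.norm_integral_le_of_norm_le t.2.1 (MeasureTheory.ae_of_all _ hbound)
            ((continuous_const.mul (continuous_pow n)).intervalIntegrable _ _)
      _ = ‖A‖ ^ (n + 1) * (t : ℝ) ^ (n + 1) / (n + 1).factorial * ‖h‖ := by
          rw [intervalIntegral.integral_const_mul, integral_pow, Nat.factorial_succ]
          push_cast
          field_simp
          simp

theorem isUnit_one_sub_volterra [CompleteSpace E] (A : C(I, E →L[ℝ] E)) :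
    IsUnit (1 - volterra A) := by
  obtain ⟨n, hn⟩ := ((FloorSemiring.tendsto_pow_div_factorial_atTop ‖A‖).eventually
    (gt_mem_nhds one_pos)).exists
  have hpow : ‖volterra A ^ n‖ < 1 := by
    refine (ContinuousLinearMap.opNorm_le_bound _ (by positivity) fun h => ?_).trans_lt hn
    refine (ContinuousMap.norm_le _ (by positivity)).2 fun t => ?_
    refine (norm_volterra_pow_apply_le A n h t).trans ?_
    gcongr
    exact mul_le_of_le_one_right (by positivity) (pow_le_one₀ t.2.1 t.2.2)
  have hunit : IsUnit (1 - volterra A ^ n) :=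
    isUnit_one_sub_of_norm_lt_one (R := C(I, E) →L[ℝ] C(I, E)) hpow
  rw [← mul_neg_geom_sum (volterra A) n] at hunit
  have hcomm : Commute (1 - volterra A) (∑ i ∈ Finset.range n, volterra A ^ i) :=
    (Commute.one_left _).sub_left
      (Commute.sum_right _ _ _ fun i _ => Commute.self_pow (volterra A) i)
  exact (hcomm.isUnit_mul_iff.1 hunit).1

end Volterra

section Picard

open Topology unitInterval

variable {E : Type*} [NormedAddCommGroup E] [NormedSpace ℝ E]

/-- The Picard operator of `γ' = c F(γ)`, `γ 0 = x` on the unit interval, with the data `(x, c)`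
as its first argument. Scaling the field by `c` makes the time span a parameter. -/
noncomputable def picardMap (F : C(E, E)) (q : (E × ℝ) × C(I, E)) : C(I, E) :=
  ContinuousMap.const I q.1.1 + q.1.2 • primitiveL (F.comp q.2)

theorem contDiff_picardMap {F : C(E, E)} (hF : ContDiff ℝ 1 F) : ContDiff ℝ 1 (picardMap F) := by
  let constL : E →L[ℝ] C(I, E) := LinearMap.mkContinuous
    { toFun := fun x => ContinuousMap.const I x
      map_add' := fun _ _ => rfl
      map_smul' := fun _ _ => rfl } 1
    (fun x => (ContinuousMap.norm_le _ (by positivity)).2 fun _ => (one_mul ‖x‖).ge)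
  have hcomp : ContDiff ℝ 1 fun q : (E × ℝ) × C(I, E) => F.comp q.2 :=
    (contDiff_continuousMap_comp hF).comp contDiff_snd
  change ContDiff ℝ 1 fun q : (E × ℝ) × C(I, E) => constL q.1.1 + q.1.2 • primitiveL (F.comp q.2)
  fun_prop

theorem hasFDerivAt_picardMap_right {F : C(E, E)} {F' : C(E, E →L[ℝ] E)}
    (hF : ∀ y, HasFDerivAt F (F' y) y) (p : E × ℝ) (γ : C(I, E)) :
    HasFDerivAt (fun γ => picardMap F (p, γ)) (volterra (p.2 • F'.comp γ)) γ := by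
  have h : volterra (p.2 • F'.comp γ) = p.2 • primitiveL ∘L pointwiseApplyL (F'.comp γ) := by
    rw [volterra, map_smul, ContinuousLinearMap.comp_smul]
  rw [h]
  have hprim : HasFDerivAt (fun γ => primitiveL (F.comp γ))
      (primitiveL ∘L pointwiseApplyL (F'.comp γ)) γ :=
    HasFDerivAt.comp (g := primitiveL) γ (primitiveL (E := E)).hasFDerivAt
      (hasFDerivAt_continuousMap_comp hF γ)
  exact (hprim.const_smul p.2).const_add (ContinuousMap.const I p.1)

theorem exists_contDiffAt_picardMap_eq_self [CompleteSpace E] {F : C(E, E)} (hF : ContDiff ℝ 1 F)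
    {p₀ : E × ℝ} {γ₀ : C(I, E)} (h₀ : picardMap F (p₀, γ₀) = γ₀) :
    ∃ Γ : E × ℝ → C(I, E), ContDiffAt ℝ 1 Γ p₀ ∧ ∀ᶠ p in 𝓝 p₀, picardMap F (p, Γ p) = Γ p := by
  let F' : C(E, E →L[ℝ] E) := ⟨fderiv ℝ F, hF.continuous_fderiv one_ne_zero⟩
  have hF' : ∀ y, HasFDerivAt F (F' y) y := fun y =>
    (hF.differentiable one_ne_zero y).hasFDerivAt
  let f : (E × ℝ) × C(I, E) → C(I, E) := fun q => q.2 - picardMap F q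
  have hf : ContDiff ℝ 1 f := contDiff_snd.sub (contDiff_picardMap hF)
  have hpartial :
      fderiv ℝ f (p₀, γ₀) ∘L .inr ℝ (E × ℝ) C(I, E) = 1 - volterra (p₀.2 • F'.comp γ₀) :=
    ((hf.differentiable one_ne_zero (p₀, γ₀)).hasFDerivAt.comp γ₀
      (hasFDerivAt_prodMk_right p₀ γ₀)).unique
      ((hasFDerivAt_id γ₀).sub (hasFDerivAt_picardMap_right hF' p₀ γ₀))
  have hinv : (fderiv ℝ f (p₀, γ₀) ∘L .inr ℝ (E × ℝ) C(I, E)).IsInvertible := by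
    rw [hpartial]
    obtain ⟨U, hU⟩ := isUnit_one_sub_volterra (p₀.2 • F'.comp γ₀)
    exact ⟨ContinuousLinearEquiv.unitsEquiv ℝ C(I, E) U, hU⟩
  have hf₀ : ContDiffAt ℝ 1 f (p₀, γ₀) := hf.contDiffAt
  refine ⟨hf₀.implicitFunction one_ne_zero hinv,
    hf₀.contDiffAt_implicitFunction one_ne_zero hinv, ?_⟩
  filter_upwards [hf₀.eventually_apply_implicitFunction one_ne_zero hinv] with p hp
  rw [show f (p₀, γ₀) = 0 from sub_eq_zero.2 h₀.symm] at hp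
  exact (sub_eq_zero.1 hp).symm

end Picard

section IntegralCurves

open Set Filter Topology

variable {E G : Type*} [NormedAddCommGroup E] [NormedSpace ℝ E]
  [NormedAddCommGroup G] [NormedSpace ℝ G] {F : E → E}

theorem eqOn_uIcc_of_isIntegralCurveOn (hF : LocallyLipschitz F) {γ δ : ℝ → E} {a b : ℝ}
    (hγ : IsIntegralCurveOn γ (fun _ => F) (uIcc a b))
    (hδ : IsIntegralCurveOn δ (fun _ => F) (uIcc a b)) (h : γ a = δ a) : EqOn γ δ (uIcc a b) := by
  have hcompact : IsCompact (γ '' uIcc a b ∪ δ '' uIcc a b) :=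
    (isCompact_uIcc.image_of_continuousOn hγ.continuousOn).union
      (isCompact_uIcc.image_of_continuousOn hδ.continuousOn)
  obtain ⟨K, hK⟩ := hF.locallyLipschitzOn.exists_lipschitzOnWith_of_compact hcompact
  have hγ_mem : ∀ t ∈ uIcc a b, γ t ∈ γ '' uIcc a b ∪ δ '' uIcc a b :=
    fun t ht => .inl (mem_image_of_mem γ ht)
  have hδ_mem : ∀ t ∈ uIcc a b, δ t ∈ γ '' uIcc a b ∪ δ '' uIcc a b :=
    fun t ht => .inr (mem_image_of_mem δ ht)
  generalize γ '' uIcc a b ∪ δ '' uIcc a b = S at hK hγ_mem hδ_mem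
  rcases le_total a b with hab | hab
  · rw [uIcc_of_le hab] at *
    have hderiv {α : ℝ → E} (hα : IsIntegralCurveOn α (fun _ => F) (Icc a b)) (t : ℝ)
        (ht : t ∈ Ico a b) : HasDerivWithinAt α (F (α t)) (Ici t) t :=
      (hα t (Ico_subset_Icc_self ht)).mono_of_mem_nhdsWithin
        (mem_of_superset (Icc_mem_nhdsGE ht.2) (Icc_subset_Icc_left ht.1))
    exact ODE_solution_unique_of_mem_Icc_right (v := fun _ => F) (s := fun _ => S)
      (fun _ _ => hK) hγ.continuousOn (hderiv hγ) (fun t ht => hγ_mem t (Ico_subset_Icc_self ht))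
      hδ.continuousOn (hderiv hδ) (fun t ht => hδ_mem t (Ico_subset_Icc_self ht)) h
  · rw [uIcc_of_ge hab] at *
    have hderiv {α : ℝ → E} (hα : IsIntegralCurveOn α (fun _ => F) (Icc b a)) (t : ℝ)
        (ht : t ∈ Ioc b a) : HasDerivWithinAt α (F (α t)) (Iic t) t :=
      (hα t (Ioc_subset_Icc_self ht)).mono_of_mem_nhdsWithin
        (mem_of_superset (Icc_mem_nhdsLE ht.1) (Icc_subset_Icc_right ht.2))
    exact ODE_solution_unique_of_mem_Icc_left (v := fun _ => F) (s := fun _ => S)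
      (fun _ _ => hK) hγ.continuousOn (hderiv hγ) (fun t ht => hγ_mem t (Ioc_subset_Icc_self ht))
      hδ.continuousOn (hderiv hδ) (fun t ht => hδ_mem t (Ioc_subset_Icc_self ht)) h

theorem exists_isIntegralCurve_of_forall_Icc (hF : LocallyLipschitz F) {x : E}
    (hx : ∀ T : ℝ, ∃ γ : ℝ → E, γ 0 = x ∧ IsIntegralCurveOn γ (fun _ => F) (Icc (-T) T)) :
    ∃ γ : ℝ → E, γ 0 = x ∧ IsIntegralCurve γ (fun _ => F) := by
  choose γ hγ₀ hγ using hx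
  have hsubset {t T : ℝ} (ht : |t| ≤ T) : uIcc 0 t ⊆ Icc (-T) T :=
    uIcc_subset_Icc (by simpa using (abs_nonneg t).trans ht) (abs_le.1 ht)
  have hglue {T : ℝ} : EqOn (fun t => γ |t| t) (γ T) (Icc (-T) T) := fun t ht =>
    eqOn_uIcc_of_isIntegralCurveOn hF ((hγ _).mono (hsubset le_rfl))
      ((hγ T).mono (hsubset (abs_le.2 ht))) ((hγ₀ _).trans (hγ₀ T).symm) right_mem_uIcc
  refine ⟨fun t => γ |t| t, hγ₀ _, fun t => ?_⟩
  have hnhds : Icc (-(|t| + 1)) (|t| + 1) ∈ 𝓝 t :=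
    Icc_mem_nhds (by linarith [neg_abs_le t]) (by linarith [le_abs_self t])
  have hderiv := (hγ (|t| + 1)).isIntegralCurveAt hnhds |>.hasDerivAt
  rw [← hglue (mem_of_mem_nhds hnhds)] at hderiv
  exact hderiv.congr_of_eventuallyEq (hglue.eventuallyEq_of_mem hnhds)

theorem integral_comp_eq_sub_of_isIntegralCurveOn [CompleteSpace G] {A g : E → G}
    (hA : Differentiable ℝ A) (hAF : ∀ y, fderiv ℝ A y (F y) = g y) (hg : Continuous g)
    {γ : ℝ → E} {a b : ℝ} (hγ : IsIntegralCurveOn γ (fun _ => F) (uIcc a b)) :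
    ∫ s in a..b, g (γ s) = A (γ b) - A (γ a) := by
  refine intervalIntegral.integral_eq_sub_of_hasDeriv_right
    (hA.continuous.comp_continuousOn hγ.continuousOn) (fun t ht => ?_)
    (hg.comp_continuousOn hγ.continuousOn).intervalIntegrable
  have hγt : HasDerivAt γ (F (γ t)) t :=
    (hγ.isIntegralCurveAt (Icc_mem_nhds ht.1 ht.2)).hasDerivAt
  simpa only [hAF] using ((hA (γ t)).hasFDerivAt.comp_hasDerivAt t hγt).hasDerivWithinAt

theorem isIntegralCurveOn_comp_of_fderiv_eq {H : G → G} {Φ : E → G} (hΦ : Differentiable ℝ Φ)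
    (hΦF : ∀ y, fderiv ℝ Φ y (F y) = H (Φ y)) {γ : ℝ → E} {s : Set ℝ}
    (hγ : IsIntegralCurveOn γ (fun _ => F) s) :
    IsIntegralCurveOn (fun t => Φ (γ t)) (fun _ => H) s := fun t ht => by
  simpa only [hΦF, Function.comp_def] using (hΦ (γ t)).hasFDerivAt.comp_hasDerivWithinAt t (hγ t ht)

theorem exists_isIntegralCurveOn_range_timeChange {p : E → ℝ} (hp : Continuous p)
    (hp_pos : ∀ y, 0 < p y) {β : ℝ → E} (hβ : IsIntegralCurve β (fun _ y => p y • F y)) :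
    ∃ γ : ℝ → E, (∀ s, γ (∫ r in (0 : ℝ)..s, p (β r)) = β s) ∧
      IsIntegralCurveOn γ (fun _ => F) (range fun s => ∫ r in (0 : ℝ)..s, p (β r)) := by
  set θ : ℝ → ℝ := fun s => ∫ r in (0 : ℝ)..s, p (β r)
  have hθ (s : ℝ) : HasStrictDerivAt θ (p (β s)) s :=
    (hp.comp hβ.continuous).integral_hasStrictDerivAt 0 s
  have hθ_mono : StrictMono θ := strictMono_of_deriv_pos fun s => by
    rw [(hθ s).hasDerivAt.deriv]
    exact hp_pos _
  have hinv (s : ℝ) : Function.invFun θ (θ s) = s :=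
    Function.leftInverse_invFun hθ_mono.injective s
  refine ⟨β ∘ Function.invFun θ, fun s => congrArg β (hinv s), ?_⟩
  rintro _ ⟨s, rfl⟩
  have hγ : HasDerivAt (β ∘ Function.invFun θ) ((p (β s))⁻¹ • p (β s) • F (β s)) (θ s) := by
    refine HasDerivAt.scomp (θ s) ?_
      ((hθ s).to_local_left_inverse (hp_pos _).ne' (.of_forall hinv)).hasDerivAt
    simpa only [hinv] using hβ s
  rw [inv_smul_smul₀ (hp_pos _).ne'] at hγ
  simpa only [Function.comp_apply, hinv] using hγ.hasDerivWithinAt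

end IntegralCurves

/-- The complete flow of the vector field `F`: time comes first, and `φ · x` is the orbit of `x`. -/
structure IsGlobalFlow {E : Type*} [NormedAddCommGroup E] [NormedSpace ℝ E] (φ : ℝ → E → E)
    (F : E → E) : Prop where
  map_zero : ∀ x, φ 0 x = x
  isIntegralCurve : ∀ x, IsIntegralCurve (fun t => φ t x) (fun _ => F)

theorem exists_isGlobalFlow_of_bounded {E : Type*} [NormedAddCommGroup E] [NormedSpace ℝ E]
    [ProperSpace E] {F : E → E} (hF : LocallyLipschitz F) {C : ℝ} (hC : ∀ y, ‖F y‖ ≤ C) :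
    ∃ φ, IsGlobalFlow φ F := by
  lift C to NNReal using (norm_nonneg _).trans (hC 0)
  have hlocal (x : E) (T : ℝ) :
      ∃ γ : ℝ → E, γ 0 = x ∧ IsIntegralCurveOn γ (fun _ => F) (Set.Icc (-T) T) := by
    rcases lt_or_ge T 0 with hT | hT
    · exact ⟨fun _ => x, rfl, by simp [IsIntegralCurveOn, Set.Icc_eq_empty, hT]⟩
    lift T to NNReal using hT
    obtain ⟨K, hK⟩ := hF.locallyLipschitzOn.exists_lipschitzOnWith_of_compact
      (isCompact_closedBall x (C * T : NNReal))
    have hpl : IsPicardLindelof (fun _ => F) (⟨0, by simp⟩ : Set.Icc (-(T : ℝ)) T) x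
        (C * T) 0 C K :=
      { lipschitzOnWith := fun _ _ => hK
        continuousOn := fun _ _ => continuousOn_const
        norm_le := fun _ _ y _ => hC y
        mul_max_le := by simp }
    exact hpl.exists_eq_forall_mem_Icc_hasDerivWithinAt₀
  choose φ hφ₀ hφ using fun x => exists_isIntegralCurve_of_forall_Icc hF (hlocal x)
  exact ⟨fun t x => φ x t, hφ₀, hφ⟩

namespace IsGlobalFlow

open Set unitInterval

variable {E : Type*} [NormedAddCommGroup E] [NormedSpace ℝ E] {φ : ℝ → E → E} {F : E → E}

theorem continuous_orbit (hφ : IsGlobalFlow φ F) (x : E) : Continuous fun t => φ t x :=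
  (hφ.isIntegralCurve x).continuous

theorem map_add (hφ : IsGlobalFlow φ F) (hF : LocallyLipschitz F) (s t : ℝ) (x : E) :
    φ (s + t) x = φ s (φ t x) :=
  eqOn_uIcc_of_isIntegralCurveOn (a := 0) (b := s) hF
    (((hφ.isIntegralCurve x).comp_add t).isIntegralCurveOn _)
    ((hφ.isIntegralCurve (φ t x)).isIntegralCurveOn _)
    (by simp [hφ.map_zero]) right_mem_uIcc

/-- The orbit of `p.1` up to time `p.2`, reparametrised by the unit interval so that all orbit
segments live in the same function space. -/
def orbitSegment (hφ : IsGlobalFlow φ F) (p : E × ℝ) : C(I, E) :=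
  ⟨fun r => φ (p.2 * r) p.1,
    (hφ.continuous_orbit p.1).comp (continuous_const.mul continuous_subtype_val)⟩

theorem isIntegralCurve_scaled (hφ : IsGlobalFlow φ F) (p : E × ℝ) :
    IsIntegralCurve (fun r => φ (p.2 * r) p.1) (fun _ y => p.2 • F y) := by
  intro r
  simpa only [Function.comp_def, mul_comm, Pi.smul_apply] using
    (hφ.isIntegralCurve p.1).comp_mul p.2 r

variable [CompleteSpace E]

theorem picardMap_orbitSegment (hφ : IsGlobalFlow φ F) (hF : Continuous F) (p : E × ℝ) :
    picardMap ⟨F, hF⟩ (p, hφ.orbitSegment p) = hφ.orbitSegment p := by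
  ext t
  have hint : ∫ s in (0 : ℝ)..t, p.2 • F (φ (p.2 * s) p.1) = φ (p.2 * t) p.1 - φ (p.2 * 0) p.1 :=
    integral_comp_eq_sub_of_isIntegralCurveOn (A := id) differentiable_id (by simp)
      (hF.const_smul p.2) ((hφ.isIntegralCurve_scaled p).isIntegralCurveOn _)
  have hprim : primitiveL ((⟨F, hF⟩ : C(E, E)).comp (hφ.orbitSegment p)) t =
      ∫ s in (0 : ℝ)..t, F (φ (p.2 * s) p.1) :=
    primitiveL_apply_of_forall_eq (fun _ => rfl) t
  calc picardMap ⟨F, hF⟩ (p, hφ.orbitSegment p) t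
      = p.1 + p.2 • ∫ s in (0 : ℝ)..t, F (φ (p.2 * s) p.1) := by rw [← hprim]; rfl
    _ = hφ.orbitSegment p t := by
      rw [← intervalIntegral.integral_smul, hint, mul_zero, hφ.map_zero, add_sub_cancel]
      rfl

theorem eq_orbitSegment_of_picardMap_eq_self (hφ : IsGlobalFlow φ F) (hF : LocallyLipschitz F)
    {p : E × ℝ} {Γ : C(I, E)} (hΓ : picardMap ⟨F, hF.continuous⟩ (p, Γ) = Γ) :
    Γ = hφ.orbitSegment p := by
  let β : ℝ → E := IccExtend zero_le_one Γ
  have hβ_cont : Continuous β := Γ.continuous.Icc_extend'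
  have hβ_eq (t : ℝ) (ht : t ∈ I) : β t = p.1 + p.2 • ∫ s in (0 : ℝ)..t, F (β s) := by
    rw [show β t = Γ ⟨t, ht⟩ from IccExtend_of_mem _ _ ht]
    exact (DFunLike.congr_fun hΓ ⟨t, ht⟩).symm
  have hβ : IsIntegralCurveOn β (fun _ y => p.2 • F y) I := fun t ht =>
    ((((hF.continuous.comp hβ_cont).integral_hasStrictDerivAt 0 t).hasDerivAt.const_smul
      p.2).const_add p.1).hasDerivWithinAt.congr_of_mem hβ_eq ht
  have hscaled : LocallyLipschitz fun y => p.2 • F y :=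
    (lipschitzWith_smul p.2).locallyLipschitz.comp hF
  have heqOn : EqOn β (fun r => φ (p.2 * r) p.1) (uIcc 0 1) :=
    eqOn_uIcc_of_isIntegralCurveOn hscaled (by rwa [uIcc_of_le zero_le_one])
      ((hφ.isIntegralCurve_scaled p).isIntegralCurveOn _)
      (by rw [hβ_eq 0 (by simp)]; simp [hφ.map_zero])
  ext t
  rw [uIcc_of_le zero_le_one] at heqOn
  exact (IccExtend_of_mem _ _ t.2).symm.trans (heqOn t.2)

theorem contDiff_orbitSegment (hφ : IsGlobalFlow φ F) (hF : ContDiff ℝ 1 F) :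
    ContDiff ℝ 1 hφ.orbitSegment := by
  refine contDiff_iff_contDiffAt.2 fun p => ?_
  obtain ⟨Γ, hΓ, hfix⟩ := exists_contDiffAt_picardMap_eq_self (F := ⟨F, hF.continuous⟩) hF
    (hφ.picardMap_orbitSegment hF.continuous p)
  refine hΓ.congr_of_eventuallyEq ?_
  filter_upwards [hfix] with q hq
  exact (hφ.eq_orbitSegment_of_picardMap_eq_self hF.locallyLipschitz hq).symm

end IsGlobalFlow

section LevelIntegral

open unitInterval

variable {E G : Type*} [NormedAddCommGroup E] [NormedSpace ℝ E]
  [NormedAddCommGroup G] [NormedSpace ℝ G]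

/-- The integral of `g` along the orbit of `x` under the flow `φ` up to the level `{u = 0}`.
It is meant for a function `u` growing at unit speed along the orbits, so that the orbit of `x`
is on that level at time `-u x`. -/
noncomputable def levelIntegral (φ : ℝ → E → E) (u : E → ℝ) (g : E → G) (x : E) : G :=
  ∫ s in (0 : ℝ)..-u x, g (φ s x)

namespace IsGlobalFlow

variable {φ : ℝ → E → E} {F : E → E} {u : E → ℝ} {g : E → G}

theorem apply_orbit_eq_add (hφ : IsGlobalFlow φ F) (hu : Differentiable ℝ u)
    (huF : ∀ y, fderiv ℝ u y (F y) = 1) (s : ℝ) (x : E) : u (φ s x) = u x + s := by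
  have h : ∫ _ in (0 : ℝ)..s, (1 : ℝ) = u (φ s x) - u (φ 0 x) :=
    integral_comp_eq_sub_of_isIntegralCurveOn hu huF continuous_const
      ((hφ.isIntegralCurve x).isIntegralCurveOn _)
  rw [integral_one, hφ.map_zero] at h
  linarith

theorem levelIntegral_eq_smul_primitiveL (hφ : IsGlobalFlow φ F) (hg : Continuous g) (x : E) :
    levelIntegral φ u g x =
      (-u x) • primitiveL ((⟨g, hg⟩ : C(E, G)).comp (hφ.orbitSegment (x, -u x))) 1 := by
  have hprim : primitiveL ((⟨g, hg⟩ : C(E, G)).comp (hφ.orbitSegment (x, -u x))) 1 =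
      ∫ r in (0 : ℝ)..1, g (φ (-u x * r) x) :=
    primitiveL_apply_of_forall_eq (fun _ => rfl) 1
  rw [hprim, intervalIntegral.smul_integral_comp_mul_left fun s => g (φ s x), mul_zero, mul_one]
  rfl

theorem contDiff_levelIntegral [CompleteSpace E] (hφ : IsGlobalFlow φ F) (hF : ContDiff ℝ 1 F)
    (hu : ContDiff ℝ 1 u) (hg : ContDiff ℝ 1 g) : ContDiff ℝ 1 (levelIntegral φ u g) := by
  rw [funext (hφ.levelIntegral_eq_smul_primitiveL hg.continuous)]
  have horbit : ContDiff ℝ 1 fun x => hφ.orbitSegment (x, -u x) :=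
    (hφ.contDiff_orbitSegment hF).comp (contDiff_id.prodMk hu.neg)
  let integralL : C(I, G) →L[ℝ] G := ContinuousMap.evalCLM ℝ (1 : I) ∘L primitiveL
  exact hu.neg.smul (integralL.contDiff.comp
    ((contDiff_continuousMap_comp (G := ⟨g, hg.continuous⟩) hg).comp horbit))

theorem levelIntegral_orbit (hφ : IsGlobalFlow φ F) (hF : LocallyLipschitz F)
    (hu : Differentiable ℝ u) (huF : ∀ y, fderiv ℝ u y (F y) = 1) (s : ℝ) (x : E) :
    levelIntegral φ u g (φ s x) = ∫ r in s..-u x, g (φ r x) := by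
  rw [levelIntegral, hφ.apply_orbit_eq_add hu huF]
  simp only [← hφ.map_add hF]
  rw [intervalIntegral.integral_comp_add_right fun r => g (φ r x)]
  congr 1 <;> ring

theorem fderiv_levelIntegral [CompleteSpace G] (hφ : IsGlobalFlow φ F) (hF : LocallyLipschitz F)
    (hu : Differentiable ℝ u) (huF : ∀ y, fderiv ℝ u y (F y) = 1) (hg : Continuous g)
    (hA : Differentiable ℝ (levelIntegral φ u g)) (x : E) :
    fderiv ℝ (levelIntegral φ u g) x (F x) = -g x := by
  have hchain : HasDerivAt (fun s => levelIntegral φ u g (φ s x))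
      (fderiv ℝ (levelIntegral φ u g) (φ 0 x) (F (φ 0 x))) 0 :=
    (hA _).hasFDerivAt.comp_hasDerivAt 0 (hφ.isIntegralCurve x 0)
  have hcont : Continuous fun s => g (φ s x) := hg.comp (hφ.continuous_orbit x)
  have hendpoint : HasDerivAt (fun s => ∫ r in s..-u x, g (φ r x)) (-g (φ 0 x)) 0 :=
    intervalIntegral.integral_hasDerivAt_left (hcont.intervalIntegrable _ _)
      (hcont.stronglyMeasurableAtFilter _ _) hcont.continuousAt
  rw [funext fun s => hφ.levelIntegral_orbit hF hu huF s x] at hchain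
  simpa only [hφ.map_zero] using hchain.unique hendpoint

end IsGlobalFlow

end LevelIntegral

section Gradient

open Set
open scoped Gradient

variable {E G : Type*} [NormedAddCommGroup E] [InnerProductSpace ℝ E]
  [NormedAddCommGroup G] [NormedSpace ℝ G]

theorem contDiff_gradient [CompleteSpace E] {u : E → ℝ} {m n : WithTop ℕ∞}
    (hu : ContDiff ℝ n u) (hmn : m + 1 ≤ n) : ContDiff ℝ m (∇ u) :=
  (InnerProductSpace.toDual ℝ E).symm.contDiff.comp (hu.fderiv_right hmn)

theorem contDiff_laplacian [FiniteDimensional ℝ E] {f : E → G} {m n : WithTop ℕ∞}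
    (hf : ContDiff ℝ n f) (hmn : m + 2 ≤ n) : ContDiff ℝ m (Laplacian.laplacian f) := by
  rw [InnerProductSpace.laplacian_eq_iteratedFDeriv_stdOrthonormalBasis]
  exact ContDiff.sum fun i _ => (ContinuousMultilinearMap.apply ℝ (fun _ : Fin 2 => E) G
    ![stdOrthonormalBasis ℝ E i, stdOrthonormalBasis ℝ E i]).contDiff.comp
    (hf.iteratedFDeriv_right hmn)

/-- The vector field `∇u / |∇u|²`: it has the trajectories of `∇u`, parametrised so that `u` grows
at unit speed along them. It takes the junk value `0` at the critical points of `u`. -/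
noncomputable def normalizedGradient [CompleteSpace E] (u : E → ℝ) (x : E) : E :=
  (‖∇ u x‖ ^ 2)⁻¹ • ∇ u x

section Complete

variable [CompleteSpace E] {u : E → ℝ}

theorem fderiv_normalizedGradient_self {x : E} (hx : ∇ u x ≠ 0) :
    fderiv ℝ u x (normalizedGradient u x) = 1 := by
  rw [← inner_gradient_left, normalizedGradient, real_inner_smul_right,
    real_inner_self_eq_norm_sq]
  exact inv_mul_cancel₀ (pow_ne_zero 2 (norm_ne_zero_iff.2 hx))

theorem norm_normalizedGradient (u : E → ℝ) (x : E) : ‖normalizedGradient u x‖ = ‖∇ u x‖⁻¹ := by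
  rw [normalizedGradient, norm_smul, norm_inv, norm_pow, norm_norm]
  rcases eq_or_ne ‖∇ u x‖ 0 with h | h
  · simp [h]
  · field_simp

theorem contDiff_inv_norm_gradient_sq {m n : WithTop ℕ∞} (hu : ContDiff ℝ n u)
    (hmn : m + 1 ≤ n) (hu₀ : ∀ x, ∇ u x ≠ 0) : ContDiff ℝ m fun x => (‖∇ u x‖ ^ 2)⁻¹ :=
  ((contDiff_gradient hu hmn).norm_sq ℝ).inv fun x => pow_ne_zero 2 (norm_ne_zero_iff.2 (hu₀ x))

theorem contDiff_normalizedGradient {m n : WithTop ℕ∞} (hu : ContDiff ℝ n u)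
    (hmn : m + 1 ≤ n) (hu₀ : ∀ x, ∇ u x ≠ 0) : ContDiff ℝ m (normalizedGradient u) :=
  (contDiff_inv_norm_gradient_sq hu hmn hu₀).smul (contDiff_gradient hu hmn)

theorem iInf_norm_gradient_le (u : E → ℝ) (x : E) : ⨅ y, ‖∇ u y‖ ≤ ‖∇ u x‖ :=
  ciInf_le ⟨0, forall_mem_range.2 fun _ => norm_nonneg _⟩ x

theorem gradient_ne_zero_of_iInf_pos (hinf : 0 < ⨅ x, ‖∇ u x‖) (x : E) : ∇ u x ≠ 0 :=
  norm_pos_iff.1 (hinf.trans_le (iInf_norm_gradient_le u x))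

end Complete

variable [ProperSpace E] {u : E → ℝ}

theorem exists_isGlobalFlow_normalizedGradient (hu : ContDiff ℝ 2 u)
    (hinf : 0 < ⨅ x, ‖∇ u x‖) : ∃ φ, IsGlobalFlow φ (normalizedGradient u) := by
  refine exists_isGlobalFlow_of_bounded (C := (⨅ x, ‖∇ u x‖)⁻¹)
    (contDiff_normalizedGradient hu (m := 1) (by norm_num)
      (gradient_ne_zero_of_iInf_pos hinf)).locallyLipschitz fun x => ?_
  rw [norm_normalizedGradient]
  exact inv_anti₀ hinf (iInf_norm_gradient_le u x)

theorem exists_contDiff_fderiv_gradient_eq_neg [CompleteSpace G] (hu : ContDiff ℝ 2 u)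
    (hinf : 0 < ⨅ x, ‖∇ u x‖) {g : E → G} (hg : ContDiff ℝ 1 g) :
    ∃ A : E → G, ContDiff ℝ 1 A ∧ (∀ x, fderiv ℝ A x (∇ u x) = -g x) ∧
      ∀ x, u x = 0 → A x = 0 := by
  have hu₀ := gradient_ne_zero_of_iInf_pos hinf
  have hu₁ : ContDiff ℝ 1 u := hu.of_le one_le_two
  have hF : ContDiff ℝ 1 (normalizedGradient u) :=
    contDiff_normalizedGradient hu (by norm_num) hu₀
  have hpg : ContDiff ℝ 1 fun x => (‖∇ u x‖ ^ 2)⁻¹ • g x :=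
    (contDiff_inv_norm_gradient_sq hu (by norm_num) hu₀).smul hg
  obtain ⟨φ, hφ⟩ := exists_isGlobalFlow_normalizedGradient hu hinf
  have hA := hφ.contDiff_levelIntegral hF hu₁ hpg
  refine ⟨levelIntegral φ u fun x => (‖∇ u x‖ ^ 2)⁻¹ • g x, hA, fun x => ?_, fun x hx => ?_⟩
  · have h := hφ.fderiv_levelIntegral hF.locallyLipschitz (hu₁.differentiable one_ne_zero)
      (fun y => fderiv_normalizedGradient_self (hu₀ y)) hpg.continuous
      (hA.differentiable one_ne_zero) x
    rw [normalizedGradient, map_smul, ← smul_neg] at h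
    exact smul_right_injective G
      (inv_ne_zero (pow_ne_zero 2 (norm_ne_zero_iff.2 (hu₀ x)))) h
  · simp [levelIntegral, hx]

theorem exists_isIntegralCurveOn_gradient_apply_eq_zero (hu : ContDiff ℝ 2 u)
    (hinf : 0 < ⨅ x, ‖∇ u x‖) (x : E) :
    ∃ (T : ℝ) (γ : ℝ → E), γ 0 = x ∧ IsIntegralCurveOn γ (fun _ => ∇ u) (uIcc 0 T) ∧
      u (γ T) = 0 := by
  have hu₀ := gradient_ne_zero_of_iInf_pos hinf
  obtain ⟨φ, hφ⟩ := exists_isGlobalFlow_normalizedGradient hu hinf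
  have hp : Continuous fun y => (‖∇ u y‖ ^ 2)⁻¹ :=
    (contDiff_inv_norm_gradient_sq hu (m := 1) (by norm_num) hu₀).continuous
  obtain ⟨γ, hγφ, hγ⟩ := exists_isIntegralCurveOn_range_timeChange hp
    (fun y => inv_pos.2 (pow_pos (norm_pos_iff.2 (hu₀ y)) 2)) (hφ.isIntegralCurve x)
  have hγ₀ : γ 0 = x := by simpa [hφ.map_zero] using hγφ 0
  have hordConnected :
      (range fun s => ∫ r in (0 : ℝ)..s, (‖∇ u (φ r x)‖ ^ 2)⁻¹).OrdConnected :=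
    (isPreconnected_range (intervalIntegral.continuous_primitive (fun _ _ =>
      (hp.comp (hφ.continuous_orbit x)).intervalIntegrable _ _) 0)).ordConnected
  refine ⟨_, γ, hγ₀, hγ.mono (hordConnected.uIcc_subset ⟨0, by simp⟩ ⟨-u x, rfl⟩), ?_⟩
  rw [hγφ, hφ.apply_orbit_eq_add (hu.differentiable two_ne_zero)
    (fun y => fderiv_normalizedGradient_self (hu₀ y)), add_neg_cancel]

end Gradient

namespace Plane

open scoped Gradient

section VectorCalculus

theorem e_zero_eq : e 0 = !₂[1, 0] := by
  ext i
  fin_cases i <;> simp [e]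

theorem clm_apply_eq_add {G : Type*} [NormedAddCommGroup G] [NormedSpace ℝ G]
    (L : Plane →L[ℝ] G) (y : Plane) : L y = y 0 • L (e 0) + y 1 • L (e 1) := by
  have hy : y = y 0 • e 0 + y 1 • e 1 := by
    ext i
    fin_cases i <;> simp [e]
  rw [← map_smul, ← map_smul, ← map_add, ← hy]

theorem gradient_apply (u : Plane → ℝ) (x : Plane) (i : Fin 2) : ∇ u x i = fderiv ℝ u x (e i) := by
  rw [← inner_gradient_left, e, EuclideanSpace.inner_single_right]
  simp

theorem divergence_smul {σ : Plane → ℝ} {S : Plane → Plane} {x : Plane}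
    (hσ : DifferentiableAt ℝ σ x) (hS : DifferentiableAt ℝ S x) :
    divergence (fun y => σ y • S y) x = fderiv ℝ σ x (S x) + σ x * divergence S x := by
  have hcoord (i : Fin 2) : fderiv ℝ (fun y => (σ y • S y) i) x (e i) =
      σ x * fderiv ℝ (fun y => S y i) x (e i) + S x i * fderiv ℝ σ x (e i) := by
    have h : HasFDerivAt (fun y => σ y * S y i) _ x :=
      hσ.hasFDerivAt.mul (differentiableAt_euclidean.1 hS i).hasFDerivAt
    exact DFunLike.congr_fun h.fderiv (e i)
  rw [clm_apply_eq_add]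
  simp only [divergence, hcoord, Fin.sum_univ_two, smul_eq_mul]
  ring

theorem divergence_gradient {u : Plane → ℝ} {x : Plane}
    (hu : DifferentiableAt ℝ (fderiv ℝ u) x) :
    divergence (∇ u) x = Laplacian.laplacian u x := by
  have hcoord (i : Fin 2) : fderiv ℝ (fun y => ∇ u y i) x (e i) =
      fderiv ℝ (fderiv ℝ u) x (e i) (e i) := by
    simp only [gradient_apply]
    rw [fderiv_clm_apply hu (differentiableAt_const _)]
    simp
  rw [InnerProductSpace.laplacian_eq_iteratedFDeriv_orthonormalBasis u
    (EuclideanSpace.basisFun (Fin 2) ℝ)]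
  simp only [divergence, hcoord, iteratedFDeriv_two_apply, EuclideanSpace.basisFun_apply]
  rfl

theorem fderiv_perpGradient_self (v : Plane → ℝ) (x : Plane) :
    fderiv ℝ v x (perpGradient v x) = 0 := by
  rw [clm_apply_eq_add]
  simp [perpGradient, mul_comm]

theorem jacobian_mulVec (Φ : Plane → Plane) (x y : Plane) :
    (jacobian Φ x).mulVec y.ofLp = (fderiv ℝ Φ x y).ofLp := by
  rw [clm_apply_eq_add]
  ext i
  simp [jacobian, Matrix.mulVec, dotProduct, mul_comm]

theorem fderiv_pair_apply {f g : Plane → ℝ} {x : Plane} (hf : DifferentiableAt ℝ f x)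
    (hg : DifferentiableAt ℝ g x) (y : Plane) :
    fderiv ℝ (fun z => (!₂[f z, g z] : Plane)) x y = !₂[fderiv ℝ f x y, fderiv ℝ g x y] := by
  have hpair : DifferentiableAt ℝ (fun z => (!₂[f z, g z] : Plane)) x := by
    refine differentiableAt_euclidean.2 fun i => ?_
    fin_cases i
    exacts [hf, hg]
  have hcoord (i : Fin 2) : fderiv ℝ (fun z => (!₂[f z, g z] : Plane) i) x y =
      fderiv ℝ (fun z => (!₂[f z, g z] : Plane)) x y i :=
    DFunLike.congr_fun (hasFDerivWithinAt_univ.1 <| hasFDerivWithinAt_euclidean.1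
      (hasFDerivWithinAt_univ.2 hpair.hasFDerivAt) i).fderiv y
  ext i
  rw [← hcoord]
  fin_cases i <;> rfl

theorem contDiff_pair {n : WithTop ℕ∞} {f g : Plane → ℝ} (hf : ContDiff ℝ n f)
    (hg : ContDiff ℝ n g) : ContDiff ℝ n fun x => (!₂[f x, g x] : Plane) := by
  refine contDiff_euclidean.2 fun i => ?_
  fin_cases i
  exacts [hf, hg]

theorem det_jacobian_pair {f g : Plane → ℝ} {x : Plane} (hf : DifferentiableAt ℝ f x)
    (hg : DifferentiableAt ℝ g x) :
    (jacobian (fun y => !₂[f y, g y]) x).det = -fderiv ℝ f x (perpGradient g x) := by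
  rw [clm_apply_eq_add]
  simp only [Matrix.det_fin_two, jacobian, Matrix.of_apply, fderiv_pair_apply hf hg, perpGradient]
  simp
  ring

theorem isUnit_jacobian_pair {f g : Plane → ℝ} {x : Plane} (hf : DifferentiableAt ℝ f x)
    (hg : DifferentiableAt ℝ g x) (hfg : fderiv ℝ f x (perpGradient g x) ≠ 0) :
    IsUnit (jacobian (fun y => !₂[f y, g y]) x) := by
  rw [Matrix.isUnit_iff_isUnit_det, det_jacobian_pair hf hg]
  exact (neg_ne_zero.2 hfg).isUnit

end VectorCalculus

section StreamFunction

/-- The 1-form `S₁ dx₀ - S₀ dx₁`, which is closed when `S` is divergence free and whose potentials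
are the stream functions of `S`. -/
noncomputable def streamForm (S : Plane → Plane) (x : Plane) : Plane →L[ℝ] ℝ :=
  S x 1 • EuclideanSpace.proj 0 - S x 0 • EuclideanSpace.proj 1

theorem contDiff_streamForm {n : WithTop ℕ∞} {S : Plane → Plane} (hS : ContDiff ℝ n S) :
    ContDiff ℝ n (streamForm S) :=
  ((contDiff_euclidean.1 hS 1).smul contDiff_const).sub
    ((contDiff_euclidean.1 hS 0).smul contDiff_const)

theorem fderiv_streamForm_apply {S : Plane → Plane} {a : Plane} (hS : DifferentiableAt ℝ S a)
    (x y : Plane) : fderiv ℝ (streamForm S) a x y =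
      fderiv ℝ (fun z => S z 1) a x * y 0 - fderiv ℝ (fun z => S z 0) a x * y 1 := by
  have hcoord (i : Fin 2) := (differentiableAt_euclidean.1 hS i).hasFDerivAt
  have h : HasFDerivAt (streamForm S) _ a :=
    ((hcoord 1).smul_const (EuclideanSpace.proj (0 : Fin 2) : Plane →L[ℝ] ℝ)).sub
      ((hcoord 0).smul_const (EuclideanSpace.proj (1 : Fin 2) : Plane →L[ℝ] ℝ))
  rw [h.fderiv]
  rfl

theorem fderiv_streamForm_symm {S : Plane → Plane} {a : Plane} (hS : DifferentiableAt ℝ S a)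
    (hdiv : divergence S a = 0) (x y : Plane) :
    fderiv ℝ (streamForm S) a x y = fderiv ℝ (streamForm S) a y x := by
  simp only [divergence, Fin.sum_univ_two] at hdiv
  rw [fderiv_streamForm_apply hS, fderiv_streamForm_apply hS]
  simp only [clm_apply_eq_add _ x, clm_apply_eq_add _ y, smul_eq_mul]
  linear_combination (x 1 * y 0 - x 0 * y 1) * hdiv

theorem perpGradient_eq_of_hasFDerivAt_streamForm {S : Plane → Plane} {v : Plane → ℝ} {x : Plane}
    (hv : HasFDerivAt v (streamForm S x) x) : perpGradient v x = S x := by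
  ext i
  fin_cases i <;> simp [perpGradient, hv.fderiv, streamForm, e]

theorem exists_perpGradient_eq {S : Plane → Plane} (hS : ContDiff ℝ 1 S)
    (hdiv : ∀ x, divergence S x = 0) :
    ∃ v : Plane → ℝ, ContDiff ℝ 1 v ∧ ∀ x, perpGradient v x = S x := by
  have hω : ContDiff ℝ 1 (streamForm S) := contDiff_streamForm hS
  obtain ⟨v, hv⟩ := convex_univ.exists_forall_hasFDerivAt_of_fderiv_symmetric isOpen_univ
    (hω.differentiable one_ne_zero).differentiableOn
    fun x _ => fderiv_streamForm_symm (hS.differentiable one_ne_zero x) (hdiv x)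
  exact ⟨v, contDiff_one_iff_hasFDerivAt.2 ⟨streamForm S, hω.continuous, fun x => hv x trivial⟩,
    fun x => perpGradient_eq_of_hasFDerivAt_streamForm (hv x trivial)⟩

end StreamFunction

section Rectification

variable {u : Plane → ℝ}

theorem exists_crossingTime (hu : ContDiff ℝ 2 u) (hinf : 0 < ⨅ x, ‖∇ u x‖) :
    ∃ τ : Plane → ℝ, ContDiff ℝ 1 τ ∧ (∀ x, fderiv ℝ τ x (∇ u x) = -1) ∧
      ∀ x T, ReachesZeroLevelAt u x T ↔ T = τ x := by
  obtain ⟨τ, hτ, hτ_grad, hτ_zero⟩ :=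
    exists_contDiff_fderiv_gradient_eq_neg hu hinf (g := fun _ => (1 : ℝ)) contDiff_const
  have hτ_unique {x : Plane} {T : ℝ} (h : ReachesZeroLevelAt u x T) : T = τ x := by
    obtain ⟨γ, ⟨rfl, hγ⟩, hγT⟩ := h
    have hint : ∫ _ in (0 : ℝ)..T, (-1 : ℝ) = τ (γ T) - τ (γ 0) :=
      integral_comp_eq_sub_of_isIntegralCurveOn (hτ.differentiable one_ne_zero) hτ_grad
        continuous_const hγ
    simpa [hτ_zero _ hγT] using hint
  refine ⟨τ, hτ, hτ_grad, fun x T => ⟨hτ_unique, ?_⟩⟩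
  rintro rfl
  obtain ⟨T, γ, hγ₀, hγ, hγT⟩ := exists_isIntegralCurveOn_gradient_apply_eq_zero hu hinf x
  have hreach : ReachesZeroLevelAt u x T := ⟨γ, ⟨hγ₀, hγ⟩, hγT⟩
  exact hτ_unique hreach ▸ hreach

theorem IsGradientTrajectory.apply_eq_zero_of_reachesZeroLevelAt (hu : ContDiff ℝ 2 u)
    {x : Plane} {T : ℝ} {γ : ℝ → Plane} (hγ : IsGradientTrajectory u x T γ)
    (hT : ReachesZeroLevelAt u x T) : u (γ T) = 0 := by
  obtain ⟨δ, hδ, hδT⟩ := hT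
  have hgrad : LocallyLipschitz (∇ u) :=
    (contDiff_gradient hu (m := 1) (by norm_num)).locallyLipschitz
  rwa [eqOn_uIcc_of_isIntegralCurveOn hgrad hγ.2 hδ.2 (hγ.1.trans hδ.1.symm) Set.right_mem_uIcc]

theorem exists_conductivity (hu : ContDiff ℝ 3 u) (hinf : 0 < ⨅ x, ‖∇ u x‖) :
    ∃ σ : Plane → ℝ, ContDiff ℝ 1 σ ∧ (∀ x, 0 < σ x) ∧
      (∀ x T γ, IsGradientTrajectory u x T γ → u (γ T) = 0 →
        σ x = Real.exp (∫ s in (0 : ℝ)..T, Laplacian.laplacian u (γ s))) ∧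
      ∀ x, divergence (fun y => σ y • ∇ u y) x = 0 := by
  have hΔ : ContDiff ℝ 1 (Laplacian.laplacian u) := contDiff_laplacian hu (by norm_num)
  obtain ⟨ρ, hρ, hρ_grad, hρ_zero⟩ :=
    exists_contDiff_fderiv_gradient_eq_neg (hu.of_le (by norm_num)) hinf hΔ
  refine ⟨fun x => Real.exp (ρ x), hρ.exp, fun x => Real.exp_pos _, ?_, fun x => ?_⟩
  · rintro _ T γ ⟨rfl, hγ⟩ hγT
    have hint := integral_comp_eq_sub_of_isIntegralCurveOn (hρ.differentiable one_ne_zero)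
      hρ_grad hΔ.continuous.neg hγ
    rw [intervalIntegral.integral_neg, hρ_zero _ hγT, zero_sub, neg_inj] at hint
    rw [hint]
  · have hρx := hρ.differentiable one_ne_zero x
    have hgrad : DifferentiableAt ℝ (∇ u) x :=
      (contDiff_gradient hu (m := 1) (by norm_num)).differentiable one_ne_zero x
    have hfderiv : DifferentiableAt ℝ (fderiv ℝ u) x :=
      (hu.fderiv_right (m := 1) (by norm_num)).differentiable one_ne_zero x
    rw [divergence_smul hρx.exp hgrad, divergence_gradient hfderiv, fderiv_exp hρx]
    simp [hρ_grad]

end Rectification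

end Plane

theorem mainTheorem7 (u : Plane → ℝ) (hu : ContDiff ℝ 3 u)
    (hinf : 0 < ⨅ x : Plane, ‖gradient u x‖) :
    ∃ (Φ : Plane → Plane) (τ σ v : Plane → ℝ),
      -- `Φ` is `C¹`, its Jacobian is everywhere invertible, and it maps `∇u` to `e₁`
      ContDiff ℝ 1 Φ ∧
      (∀ x, IsUnit (Plane.jacobian Φ x)) ∧
      (∀ x, (Plane.jacobian Φ x).mulVec (gradient u x).ofLp = ![1, 0]) ∧
      -- `Φ` carries solutions of `X' = ∇u(X)`, on any time set, to solutions of `Y' = e₁`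
      (∀ (X : ℝ → Plane) (s : Set ℝ), IsIntegralCurveOn X (fun _ y => gradient u y) s →
        IsIntegralCurveOn (fun t => Φ (X t)) (fun _ _ => Plane.e 0) s) ∧
      -- `Φ = (-τ, v)`
      (∀ x, Φ x = !₂[-τ x, v x]) ∧
      -- `τ x` is the unique time at which the trajectory from `x` reaches `{u = 0}`
      ContDiff ℝ 1 τ ∧
      (∀ x T, Plane.ReachesZeroLevelAt u x T ↔ T = τ x) ∧
      -- `σ` is the conductivity given by the integral of the Laplacian along trajectories
      ContDiff ℝ 1 σ ∧
      (∀ x, 0 < σ x) ∧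
      (∀ x γ, Plane.IsGradientTrajectory u x (τ x) γ →
        σ x = Real.exp (∫ s in (0 : ℝ)..τ x, Laplacian.laplacian u (γ s))) ∧
      (∀ x, Plane.divergence (fun y => σ y • gradient u y) x = 0) ∧
      -- `v` is a stream function of `σ∇u`
      ContDiff ℝ 1 v ∧
      (∀ x, σ x • gradient u x = Plane.perpGradient v x) := by
  have hu₂ : ContDiff ℝ 2 u := hu.of_le (by norm_num)
  obtain ⟨τ, hτ, hτ_grad, hτ_iff⟩ := Plane.exists_crossingTime hu₂ hinf
  obtain ⟨σ, hσ, hσ_pos, hσ_exp, hσ_div⟩ := Plane.exists_conductivity hu hinf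
  obtain ⟨v, hv, hv_perp⟩ := Plane.exists_perpGradient_eq
    (hσ.smul (contDiff_gradient hu₂ (by norm_num))) hσ_div
  have hτ_diff : Differentiable ℝ fun x => -τ x := (hτ.differentiable one_ne_zero).neg
  have hv_diff : Differentiable ℝ v := hv.differentiable one_ne_zero
  have hτ_neg (x : Plane) : fderiv ℝ (fun y => -τ y) x (gradient u x) = 1 := by
    simp [fderiv_fun_neg, hτ_grad]
  have hv_grad (x : Plane) : fderiv ℝ v x (gradient u x) = 0 := by
    simpa [hv_perp, (hσ_pos x).ne'] using Plane.fderiv_perpGradient_self v x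
  have hΦ_grad (x : Plane) :
      fderiv ℝ (fun y => (!₂[-τ y, v y] : Plane)) x (gradient u x) = !₂[1, 0] := by
    rw [Plane.fderiv_pair_apply (hτ_diff x) (hv_diff x), hτ_neg, hv_grad]
  have hΦ : ContDiff ℝ 1 fun x => (!₂[-τ x, v x] : Plane) := Plane.contDiff_pair hτ.neg hv
  refine ⟨_, τ, σ, v, hΦ, fun x => ?_, fun x => ?_, fun X s hX => ?_, fun _ => rfl, hτ, hτ_iff, hσ,
    hσ_pos, fun x γ hγ => ?_, hσ_div, hv, fun x => (hv_perp x).symm⟩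
  · refine Plane.isUnit_jacobian_pair (hτ_diff x) (hv_diff x) ?_
    simpa [hv_perp, hτ_grad] using (hσ_pos x).ne'
  · rw [Plane.jacobian_mulVec, hΦ_grad]
  · exact isIntegralCurveOn_comp_of_fderiv_eq (hΦ.differentiable one_ne_zero)
      (fun y => (hΦ_grad y).trans Plane.e_zero_eq.symm) hX
  · exact hσ_exp x _ γ hγ (hγ.apply_eq_zero_of_reachesZeroLevelAt hu₂ ((hτ_iff x _).2 rfl))
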